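/- Let $T$ be a locally finite (infinite) tree and fix a point $\omega_*$ of its boundary at infinity. For a vertex $x$, let $\mathfrak p(x)$ be the neighbour of $x$ on the semi-infinite geodesic from $x$ to $\omega_*$, and let $\mathrm{succ}(x)$ be the set of all other neighbours of $x$. Let $m:T\to(0,\infty)$ be a flow measure, i.e. $m(x)=\sum_{y\in \mathrm{succ}(x)}m(y)$ for all $x\in T$, identified with the measure on $T$ with density $m$ with respect to the counting measure. The flow Laplacian is $\mathcal L=\tfrac12\nabla^*\nabla$, where for $f:T\to\mathbb C$ $$\nabla f(x)=f(x)-f(\mathfrak p(x)),\qquad \nabla^* f(x)=f(x)-\frac1{m(x)}\sum_{y\in \mathrm{succ}(x)}f(y)\,m(y).$$ Then, for every $p\in[1,\infty]$, $\mathcal L$ is a bounded operator on the complex space $L^p(m)$, and its spectrum there is the interval $[0,2]$. -/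

import Mathlib

open MeasureTheory
open scoped ENNReal

/-- An infinite chain in a graph: consecutive vertices are adjacent and there is no backtracking.
In a tree, these are exactly the semi-infinite geodesics. -/
structure InfiniteChain {V : Type*} (G : SimpleGraph V) where
  vertex : ℕ → V
  adj : ∀ n, G.Adj (vertex n) (vertex (n + 1))
  no_backtrack : ∀ n, vertex (n + 2) ≠ vertex n

namespace InfiniteChain

variable {V : Type*} {G : SimpleGraph V}

/-- Two infinite chains are equivalent if, up to a shift of the index, they eventually coincide. -/
def Equivalent (r s : InfiniteChain G) : Prop :=
  ∃ a b : ℕ, ∀ n, r.vertex (n + a) = s.vertex (n + b)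

theorem equivalent_refl (r : InfiniteChain G) : r.Equivalent r := ⟨0, 0, fun _ => rfl⟩

theorem equivalent_symm {r s : InfiniteChain G} (h : r.Equivalent s) : s.Equivalent r := by
  obtain ⟨a, b, hab⟩ := h
  exact ⟨b, a, fun n => (hab n).symm⟩

theorem equivalent_trans {r s t : InfiniteChain G} (h : r.Equivalent s) (h' : s.Equivalent t) :
    r.Equivalent t := by
  obtain ⟨a, b, hab⟩ := h
  obtain ⟨c, d, hcd⟩ := h'
  refine ⟨a + c, b + d, fun n => ?_⟩
  have h1 := hab (n + c)
  have h2 := hcd (n + b)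
  rw [show n + (a + c) = n + c + a by ring, h1, show n + c + b = n + b + c by ring, h2,
    show n + (b + d) = n + b + d by ring]

instance setoid (G : SimpleGraph V) : Setoid (InfiniteChain G) where
  r := Equivalent
  iseqv := ⟨equivalent_refl, equivalent_symm, equivalent_trans⟩

/-- The chain without its first vertex. -/
def tail (r : InfiniteChain G) : InfiniteChain G where
  vertex n := r.vertex (n + 1)
  adj n := r.adj (n + 1)
  no_backtrack n := r.no_backtrack (n + 1)

/-- The chain with a new first vertex. -/
def cons (y : V) (r : InfiniteChain G) (h : G.Adj y (r.vertex 0)) (h' : r.vertex 1 ≠ y) :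
    InfiniteChain G where
  vertex n := Nat.casesOn n y r.vertex
  adj n := by
    cases n with
    | zero => exact h
    | succ n => exact r.adj n
  no_backtrack n := by
    cases n with
    | zero => exact h'
    | succ n => exact r.no_backtrack n

end InfiniteChain

/-- The boundary at infinity of a tree: infinite chains up to equivalence. -/
def TreeBoundary {V : Type*} (G : SimpleGraph V) : Type _ := Quotient (InfiniteChain.setoid G)

/-- `r` is an infinite chain starting at `x` and ending at the boundary point `ω`. -/
def InfiniteChain.Joins {V : Type*} {G : SimpleGraph V} (r : InfiniteChain G) (x : V)
    (ω : TreeBoundary G) : Prop :=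
  r.vertex 0 = x ∧ (Quotient.mk _ r : TreeBoundary G) = ω

theorem InfiniteChain.exists_joins {V : Type*} {G : SimpleGraph V} (hG : G.Connected)
    (ω : TreeBoundary G) (x : V) : ∃ r : InfiniteChain G, r.Joins x ω := by
  obtain ⟨r, rfl⟩ := Quotient.exists_rep ω
  obtain ⟨w⟩ := hG.preconnected x (r.vertex 0)
  suffices h : ∀ u v : V, G.Walk u v → (∃ s : InfiniteChain G, s.Joins v ⟦r⟧) →
      ∃ s : InfiniteChain G, s.Joins u ⟦r⟧ from h _ _ w ⟨r, rfl, rfl⟩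
  intro u v p hp
  induction p with
  | nil => exact hp
  | @cons u v w huv p ih =>
    obtain ⟨s, rfl, hs⟩ := ih hp
    by_cases h : s.vertex 1 = u
    · refine ⟨s.tail, h, ?_⟩
      rw [← hs]
      exact Quotient.sound ⟨0, 1, fun n => rfl⟩
    · refine ⟨InfiniteChain.cons u s huv h, rfl, ?_⟩
      rw [← hs]
      exact Quotient.sound ⟨1, 0, fun n => rfl⟩

/-- A locally finite tree with root at infinity, with vertex set `V`. (It is automatically
infinite, because it has a boundary point.) -/
structure TreeWithRootAtInfinity (V : Type*) where
  graph : SimpleGraph V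
  isTree : graph.IsTree
  locallyFinite : ∀ x, (graph.neighborSet x).Finite
  root : TreeBoundary graph

namespace TreeWithRootAtInfinity

variable {V : Type*} (T : TreeWithRootAtInfinity V)

/-- The semi-infinite geodesic from `x` to the root (it is unique, as the graph is a tree). -/
noncomputable def chainToRoot (x : V) : InfiniteChain T.graph :=
  (InfiniteChain.exists_joins T.isTree.connected T.root x).choose

/-- The predecessor of `x`: the neighbour of `x` on the semi-infinite geodesic from `x` to the
root. -/
noncomputable def pred (x : V) : V := (T.chainToRoot x).vertex 1

/-- The finite set of successors of `x`: all its neighbours but the predecessor. -/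
noncomputable def successors (x : V) : Finset V :=
  ((T.locallyFinite x).sdiff (t := {T.pred x})).toFinset

end TreeWithRootAtInfinity

/-- A flow measure on a tree with root at infinity. -/
structure FlowMeasure {V : Type*} (T : TreeWithRootAtInfinity V) where
  mass : V → ℝ
  mass_pos : ∀ x, 0 < mass x
  flow : ∀ x, mass x = ∑ y ∈ T.successors x, mass y

namespace FlowMeasure

variable {V : Type*} {T : TreeWithRootAtInfinity V} (m : FlowMeasure T)

/-- The measure on `V` with density `m` with respect to the counting measure. -/
noncomputable def toMeasure [MeasurableSpace V] : Measure V :=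
  Measure.count.withDensity fun x => ENNReal.ofReal (m.mass x)

/-- The shift operator `Σ f (x) = f (𝔭 x)`. -/
noncomputable def shift (_m : FlowMeasure T) (f : V → ℂ) (x : V) : ℂ := f (T.pred x)

/-- The adjoint `Σ*` of the shift operator with respect to the `L²(m)` pairing, as an operator
on all functions. -/
noncomputable def shiftAdjoint (f : V → ℂ) (x : V) : ℂ :=
  1 / (m.mass x : ℂ) * ∑ y ∈ T.successors x, f y * (m.mass y : ℂ)

/-- The flow gradient `∇ = I - Σ`. -/
noncomputable def gradient (f : V → ℂ) (x : V) : ℂ := f x - m.shift f x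

/-- The adjoint `∇* = I - Σ*` of the flow gradient. -/
noncomputable def gradientAdjoint (f : V → ℂ) (x : V) : ℂ := f x - m.shiftAdjoint f x

/-- The flow Laplacian `ℒ = (1/2) ∇* ∇`. -/
noncomputable def laplacian (f : V → ℂ) (x : V) : ℂ :=
  1 / 2 * m.gradientAdjoint (m.gradient f) x

end FlowMeasure

/-! ### Spectral theory in a Banach algebra -/

open Filter Topology

/-! The flow condition gives `Σ* Σ = I`, so `ℒ = I - (Σ + Σ*)/2`, and makes both `Σ` and `Σ*`
contractions of every `L^p(m)`. For `z ∈ ℂ` choose a root `b` of `2(1 - z)b = 1 + b²` with `0 < |b|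
≤ 1`; then `(I - bΣ*)(I - bΣ) = -2b(z - ℒ)`, and `|b| = 1` exactly when `z ∈ [0, 2]`.

If `|b| < 1`, both factors are invertible by Neumann series. If `|b| = 1` and the product is
invertible, then `I - bΣ`, a limit of invertible operators, is itself invertible
(`isUnit_of_tendsto_of_isUnit_mul`). But `Σ` has spectral radius 1, and conjugation by `c ^
(-level)` turns it into `cΣ` whenever `|c| = 1` (`exists_units_conj_shift`), so its spectrum
contains the whole unit circle: a contradiction. -/

/-- A left-invertible limit of units is a unit. -/
theorem isUnit_of_tendsto_of_isUnit_mul {A : Type*} [NormedRing A] [CompleteSpace A] {x l : A}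
    {y : ℕ → A} (hy : ∀ n, IsUnit (y n)) (hlim : Tendsto y atTop (𝓝 x)) (hl : IsUnit (l * x)) :
    IsUnit x := by
  -- Units are open, so some `l * y n` is a unit; this makes `l` a unit, and then `x`.
  have h1 : Tendsto (fun n => l * y n) atTop (𝓝 (l * x)) := hlim.const_mul l
  obtain ⟨n, hn⟩ := (h1.eventually (Units.isOpen.mem_nhds hl)).exists
  have hlu : IsUnit l := by
    obtain ⟨v, hv⟩ := hy n
    rw [← hv] at hn
    exact (Units.isUnit_mul_units l v).1 hn
  obtain ⟨v, rfl⟩ := hlu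
  exact (Units.isUnit_units_mul v x).1 hl

section BanachAlgebra

variable {A : Type*} [NormedRing A] [NormedAlgebra ℂ A] {s t : A}

theorem isUnit_one_sub_smul_of_norm_lt_one [CompleteSpace A] (hs : ‖s‖ ≤ 1) {b : ℂ}
    (hb : ‖b‖ < 1) :
    IsUnit (1 - b • s) := by
  apply isUnit_one_sub_of_norm_lt_one
  rw [norm_smul]
  nlinarith [norm_nonneg b, norm_nonneg s]

/-- Since `t ^ n * s ^ n = 1` and `t ^ n` is a contraction, `s ^ n` cannot have norm below 1. -/
theorem norm_pow_eq_one_of_mul_eq_one {A : Type*} [NormedRing A] [NormOneClass A] {s t : A}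
    (hts : t * s = 1) (hs : ‖s‖ ≤ 1) (ht : ‖t‖ ≤ 1) (n : ℕ) :
    ‖s ^ n‖ = 1 := by
  have h : t ^ n * s ^ n = 1 := by
    induction n with
    | zero => simp
    | succ n ih => rw [pow_succ, pow_succ', mul_assoc, ← mul_assoc t, hts, one_mul, ih]
  refine le_antisymm ((norm_pow_le s n).trans (pow_le_one₀ (norm_nonneg _) hs)) ?_
  have h1 : ‖t ^ n‖ ≤ 1 := (norm_pow_le t n).trans (pow_le_one₀ (norm_nonneg _) ht)
  have h2 := norm_mul_le (t ^ n) (s ^ n)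
  rw [h, norm_one] at h2
  nlinarith [norm_nonneg (s ^ n)]

theorem spectralRadius_eq_one_of_mul_eq_one [NormOneClass A] [CompleteSpace A]
    (hts : t * s = 1) (hs : ‖s‖ ≤ 1) (ht : ‖t‖ ≤ 1) :
    spectralRadius ℂ s = 1 := by
  refine tendsto_nhds_unique (spectrum.pow_norm_pow_one_div_tendsto_nhds_spectralRadius s) ?_
  simp [norm_pow_eq_one_of_mul_eq_one hts hs ht]

/-- If an isometry `s` is similar to all its rotations, then its spectrum contains the circle. -/
theorem not_isUnit_one_sub_smul_of_norm_eq_one [NormOneClass A] [CompleteSpace A]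
    (hts : t * s = 1) (hs : ‖s‖ ≤ 1)
    (ht : ‖t‖ ≤ 1) (hrot : ∀ c : ℂ, ‖c‖ = 1 → ∃ u : Aˣ, u * s * ↑u⁻¹ = c • s)
    {b : ℂ} (hb : ‖b‖ = 1) : ¬ IsUnit (1 - b • s) := by
  have : Nontrivial A := NormOneClass.nontrivial
  obtain ⟨z, hz, hzr⟩ := spectrum.exists_nnnorm_eq_spectralRadius s
  rw [spectralRadius_eq_one_of_mul_eq_one hts hs ht, ENNReal.coe_eq_one] at hzr
  have hz1 : ‖z‖ = 1 := by rw [← coe_nnnorm, hzr, NNReal.coe_one]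
  have hz0 : z ≠ 0 := by rintro rfl; simp at hz1
  -- With this rotation, `u (z - s) u⁻¹ = z (1 - b s)`.
  obtain ⟨u, hu⟩ := hrot (z * b) (by simp [hz1, hb])
  intro h
  refine spectrum.mem_iff.1 hz ?_
  have h1 : algebraMap ℂ A z - s = ↑u⁻¹ * (Units.mk0 z hz0 • (1 - b • s)) * u := by
    have h2 : (Units.mk0 z hz0 • (1 - b • s)) = u * (algebraMap ℂ A z - s) * ↑u⁻¹ := by
      rw [mul_sub, sub_mul, hu, ← Algebra.commutes, mul_assoc, Units.mul_inv, mul_one,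
        Algebra.algebraMap_eq_smul_one, Units.smul_mk0, smul_sub, smul_smul]
    rw [h2]
    simp [mul_assoc]
  rw [h1]
  exact ((u⁻¹).isUnit.mul ((isUnit_smul_iff _ _).2 h)).mul u.isUnit

/-- Factorization of the resolvent of `1 - (s + t) / 2`. -/
theorem one_sub_smul_mul_one_sub_smul (hts : t * s = 1) {z b : ℂ}
    (hb : 2 * (1 - z) * b = 1 + b ^ 2) :
    (1 - b • t) * (1 - b • s) =
      (-(2 * b)) • (algebraMap ℂ A z - (1 - (1 / 2 : ℂ) • (s + t))) := by
  have h : (1 - b • t) * (1 - b • s) = (1 + b ^ 2) • (1 : A) - b • (s + t) := by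
    simp only [sub_mul, mul_sub, one_mul, mul_one, smul_mul_smul_comm, hts]
    module
  rw [h, ← hb, Algebra.algebraMap_eq_smul_one]
  module

/-- The two roots have product 1, so one of them lies in the closed unit disc. -/
theorem exists_norm_le_one_quadratic (z : ℂ) :
    ∃ b : ℂ, b ≠ 0 ∧ ‖b‖ ≤ 1 ∧ 2 * (1 - z) * b = 1 + b ^ 2 := by
  obtain ⟨d, hd⟩ := IsAlgClosed.exists_pow_nat_eq ((1 - z) ^ 2 - 1) (n := 2) (by norm_num)
  have hprod : (1 - z + d) * (1 - z - d) = 1 := by linear_combination -hd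
  have hne : (1 - z + d) ≠ 0 ∧ (1 - z - d) ≠ 0 := by
    constructor <;> intro h <;> simp [h] at hprod
  rcases le_total ‖1 - z + d‖ 1 with h | h
  · exact ⟨_, hne.1, h, by linear_combination -hd⟩
  · refine ⟨1 - z - d, hne.2, ?_, by linear_combination -hd⟩
    have := congrArg norm hprod
    rw [norm_mul, norm_one] at this
    nlinarith [norm_nonneg (1 - z - d)]

/-- The equation says `1 - z = (b + b⁻¹)/2`; on the unit circle `b⁻¹` is the conjugate of `b`, so `z
= 1 - Re b`. -/
theorem norm_eq_one_iff_of_quadratic {z b : ℂ} (hb0 : b ≠ 0)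
    (hb : 2 * (1 - z) * b = 1 + b ^ 2) :
    ‖b‖ = 1 ↔ z ∈ ((↑) : ℝ → ℂ) '' Set.Icc 0 2 := by
  constructor
  · intro h
    have h1 : b * (starRingEnd ℂ) b = 1 := by rw [Complex.mul_conj']; simp [h]
    have h2 : (starRingEnd ℂ) b + b = ((2 * b.re : ℝ) : ℂ) := by
      rw [add_comm, Complex.add_conj]
    have h3 : z = ((1 - b.re : ℝ) : ℂ) := by
      have h4 : 2 * (1 - z) * b = (starRingEnd ℂ b + b) * b := by
        rw [hb]; linear_combination -h1
      have h5 := mul_right_cancel₀ hb0 h4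
      rw [h2] at h5
      push_cast at h5 ⊢
      linear_combination (-1 / 2 : ℂ) * h5
    have h6 := abs_le.1 ((Complex.abs_re_le_norm b).trans_eq h)
    exact ⟨1 - b.re, ⟨by linarith, by linarith⟩, h3.symm⟩
  · rintro ⟨x, ⟨hx0, hx2⟩, rfl⟩
    have hre := congrArg Complex.re hb
    have him := congrArg Complex.im hb
    simp only [pow_two, Complex.mul_re, Complex.mul_im, Complex.add_re, Complex.add_im,
      Complex.sub_re, Complex.sub_im, Complex.one_re, Complex.one_im, Complex.ofReal_re,
      Complex.ofReal_im, Complex.re_ofNat, Complex.im_ofNat] at hre him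
    have h : b.im * (b.re - (1 - x)) = 0 := by linarith
    have hsq : ‖b‖ ^ 2 = 1 := by
      rw [← Complex.normSq_eq_norm_sq, Complex.normSq_apply]
      rcases mul_eq_zero.1 h with h0 | h0
      · rw [h0] at hre ⊢
        -- For real `b` the square equals `(1 - x)² - 1`, which is at most 0 on `[0, 2]`.
        have h7 : (b.re - (1 - x)) ^ 2 = 0 :=
          le_antisymm (by nlinarith) (sq_nonneg _)
        have h8 := pow_eq_zero_iff (two_ne_zero) |>.1 h7
        have h9 : 1 - x = b.re := by linarith
        rw [h9] at hre
        linarith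
      · have h9 : 1 - x = b.re := by linarith
        rw [h9] at hre
        linarith
    nlinarith [norm_nonneg b, (pow_eq_one_iff_of_nonneg (norm_nonneg b) two_ne_zero).1 hsq]

/-- The spectrum of `1 - (s + t) / 2` when `t` is a contractive left inverse of an isometry `s`
which is similar to all its rotations. -/
theorem spectrum_one_sub_half_add [NormOneClass A] [CompleteSpace A]
    (hts : t * s = 1) (hs : ‖s‖ ≤ 1)
    (ht : ‖t‖ ≤ 1) (hrot : ∀ c : ℂ, ‖c‖ = 1 → ∃ u : Aˣ, u * s * ↑u⁻¹ = c • s) :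
    spectrum ℂ (1 - (1 / 2 : ℂ) • (s + t)) = ((↑) : ℝ → ℂ) '' Set.Icc 0 2 := by
  ext z
  obtain ⟨b, hb0, hb1, hb⟩ := exists_norm_le_one_quadratic z
  rw [← norm_eq_one_iff_of_quadratic hb0 hb, spectrum.mem_iff]
  have hunit : IsUnit (algebraMap ℂ A z - (1 - (1 / 2 : ℂ) • (s + t))) ↔
      IsUnit ((1 - b • t) * (1 - b • s)) := by
    rw [one_sub_smul_mul_one_sub_smul hts hb]
    exact (isUnit_smul_iff (Units.mk0 (-(2 * b)) (by simpa using hb0)) _).symm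
  rw [hunit]
  refine ⟨fun h => hb1.eq_of_not_lt fun hlt => h ?_, fun h1 h => ?_⟩
  · exact (isUnit_one_sub_smul_of_norm_lt_one ht hlt).mul
      (isUnit_one_sub_smul_of_norm_lt_one hs hlt)
  · refine not_isUnit_one_sub_smul_of_norm_eq_one hts hs ht hrot h1
      (isUnit_of_tendsto_of_isUnit_mul
        -- Approach `b` radially from inside the disc, where Neumann series apply.
        (y := fun n : ℕ => 1 - ((1 - 1 / ((n : ℂ) + 1)) * b) • s) (fun n => ?_) ?_ h)
    · apply isUnit_one_sub_smul_of_norm_lt_one hs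
      rw [norm_mul, h1, mul_one]
      have : (1 - 1 / ((n : ℂ) + 1)) = ((1 - 1 / ((n : ℝ) + 1) : ℝ) : ℂ) := by push_cast; rfl
      rw [this, Complex.norm_real, Real.norm_of_nonneg]
      · have : 0 < 1 / ((n : ℝ) + 1) := by positivity
        linarith
      · rw [sub_nonneg, div_le_one (by positivity)]
        linarith [n.cast_nonneg (α := ℝ)]
    · have h2 : Tendsto (fun n : ℕ => (1 - 1 / ((n : ℂ) + 1)) * b) atTop (𝓝 ((1 - 0) * b)) :=
        (tendsto_const_nhds.sub tendsto_one_div_add_atTop_nhds_zero_nat).mul_const b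
      rw [sub_zero, one_mul] at h2
      exact tendsto_const_nhds.sub (h2.smul_const s)

end BanachAlgebra

/-! ### Uniqueness of geodesics to a boundary point -/

namespace InfiniteChain

variable {V : Type*} {G : SimpleGraph V}

/-- The walk along the first `n` edges of an infinite chain. -/
def walk (r : InfiniteChain G) : ∀ n, G.Walk (r.vertex 0) (r.vertex n)
  | 0 => .nil
  | n + 1 => (r.walk n).concat (r.adj n)

theorem mk_tail (r : InfiniteChain G) : (Quotient.mk _ r.tail : TreeBoundary G) = Quotient.mk _ r :=
  Quotient.sound ⟨0, 1, fun _ => rfl⟩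

theorem mk_cons (r : InfiniteChain G) {y : V} (h : G.Adj y (r.vertex 0)) (h' : r.vertex 1 ≠ y) :
    (Quotient.mk _ (r.cons y h h') : TreeBoundary G) = Quotient.mk _ r :=
  Quotient.sound ⟨1, 0, fun _ => rfl⟩

theorem support_walk (r : InfiniteChain G) (n : ℕ) :
    (r.walk n).support = (List.range (n + 1)).map r.vertex := by
  induction n with
  | zero => simp [walk]
  | succ n ih => rw [walk, SimpleGraph.Walk.support_concat, ih, List.range_succ (n := n + 1)]; simp

theorem isPath_walk (hG : G.IsAcyclic) (r : InfiniteChain G) (n : ℕ) : (r.walk n).IsPath := by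
  induction n with
  | zero => simp [walk]
  | succ n ih =>
    refine ih.concat (fun h => ?_) (r.adj n)
    have h1 := hG.eq_penultimate_of_adj_end ih (r.adj n) h
    cases n with
    | zero => exact (r.adj 0).ne (by simpa [walk] using h1.symm)
    | succ n =>
      rw [walk, SimpleGraph.Walk.penultimate_concat] at h1
      exact r.no_backtrack n h1

theorem vertex_injective (hG : G.IsAcyclic) (r : InfiniteChain G) :
    Function.Injective r.vertex := by
  intro i j hij
  have h := (r.isPath_walk hG (i + j)).support_nodup
  rw [support_walk] at h
  exact List.inj_on_of_nodup_map h (by simp) (by simp) hij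

/-- Initial segments ending at a common vertex are paths with the same endpoints, hence equal in a
tree; compare their supports at position `n`. -/
theorem vertex_eq_of_equivalent (hG : G.IsAcyclic) {r s : InfiniteChain G}
    (h0 : r.vertex 0 = s.vertex 0) (h : r.Equivalent s) (n : ℕ) : r.vertex n = s.vertex n := by
  obtain ⟨a, b, hab⟩ := h
  have key : ∀ i j (_ : r.vertex i = s.vertex j),
      (r.walk i).support = (s.walk j).support := by
    intro i j hij
    have h1 := (hG.subsingleton_path _ _).elim ⟨(r.walk i).copy h0 hij,
      by simpa using r.isPath_walk hG i⟩ ⟨s.walk j, s.isPath_walk hG j⟩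
    have h2 := congrArg (fun p : G.Path _ _ => p.1.support) h1
    simpa using h2
  have h1 := key _ _ (hab n)
  rw [support_walk, support_walk] at h1
  have h2 := congrArg (fun l => l[n]?) h1
  have h3 : n < n + a + 1 := by omega
  have h4 : n < n + b + 1 := by omega
  simpa [h3, h4] using h2

end InfiniteChain

/-! ### Predecessors, successors and levels -/

namespace TreeWithRootAtInfinity

variable {V : Type*} (T : TreeWithRootAtInfinity V)

theorem chainToRoot_joins (x : V) : (T.chainToRoot x).Joins x T.root :=
  (InfiniteChain.exists_joins T.isTree.connected T.root x).choose_spec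

theorem chainToRoot_zero (x : V) : (T.chainToRoot x).vertex 0 = x := (T.chainToRoot_joins x).1

theorem vertex_eq_chainToRoot {r : InfiniteChain T.graph} {x : V} (hr : r.Joins x T.root) (n : ℕ) :
    r.vertex n = (T.chainToRoot x).vertex n :=
  InfiniteChain.vertex_eq_of_equivalent T.isTree.isAcyclic (hr.1.trans (T.chainToRoot_zero x).symm)
    (Quotient.exact (hr.2.trans (T.chainToRoot_joins x).2.symm)) n

theorem adj_pred (x : V) : T.graph.Adj x (T.pred x) := by
  have h := (T.chainToRoot x).adj 0
  rwa [chainToRoot_zero] at h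

theorem chainToRoot_pred (x : V) (n : ℕ) :
    (T.chainToRoot (T.pred x)).vertex n = (T.chainToRoot x).vertex (n + 1) :=
  (T.vertex_eq_chainToRoot (r := (T.chainToRoot x).tail)
    ⟨rfl, (T.chainToRoot x).mk_tail.trans (T.chainToRoot_joins x).2⟩ n).symm

theorem pred_pred_ne (x : V) : T.pred (T.pred x) ≠ x := by
  have h := (T.chainToRoot x).no_backtrack 0
  rw [chainToRoot_zero] at h
  rwa [pred, chainToRoot_pred]

/-- Prefixing `y` to the geodesic from `x` gives a chain without backtracking, hence the geodesic
from `y`. -/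
theorem pred_eq_of_adj {x y : V} (h : T.graph.Adj x y) (hy : y ≠ T.pred x) : T.pred y = x := by
  have h0 := T.chainToRoot_zero x
  rw [pred, ← T.vertex_eq_chainToRoot (x := y)
    (r := (T.chainToRoot x).cons y (by rw [h0]; exact h.symm) (Ne.symm hy))
    ⟨rfl, ((T.chainToRoot x).mk_cons _ _).trans (T.chainToRoot_joins x).2⟩ 1]
  exact h0

@[simp]
theorem mem_successors {x y : V} : y ∈ T.successors x ↔ T.pred y = x := by
  simp only [successors, Set.Finite.mem_toFinset, Set.mem_sdiff, SimpleGraph.mem_neighborSet,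
    Set.mem_singleton_iff]
  refine ⟨fun h => T.pred_eq_of_adj h.1 h.2, ?_⟩
  rintro rfl
  exact ⟨(T.adj_pred y).symm, (T.pred_pred_ne y).symm⟩

/-- A level function: the predecessor of a vertex lies one level higher. -/
theorem exists_level : ∃ l : V → ℤ, ∀ x, l (T.pred x) = l x + 1 := by
  obtain ⟨r, hr⟩ := Quotient.exists_rep T.root
  have hex : ∀ x, ∃ k : ℤ, ∃ a b : ℕ, k = b - a ∧
      ∀ n, (T.chainToRoot x).vertex (n + a) = r.vertex (n + b) := by
    intro x
    obtain ⟨a, b, hab⟩ := Quotient.exact ((T.chainToRoot_joins x).2.trans hr.symm)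
    exact ⟨_, a, b, rfl, hab⟩
  choose l hl using hex
  refine ⟨l, fun x => ?_⟩
  obtain ⟨a, b, h1, h2⟩ := hl x
  obtain ⟨c, d, h3, h4⟩ := hl (T.pred x)
  -- Both sides are the vertex of index `a + c + 1` on the geodesic from `x`; injectivity of `r`
  -- then compares `b - a` with `d - c`.
  have h5 : r.vertex (c + 1 + b) = r.vertex (a + d) := by
    rw [← h2, ← h4, chainToRoot_pred]
    congr 1
    omega
  have h6 := r.vertex_injective T.isTree.isAcyclic h5
  omega

theorem nonempty {V : Type*} (T : TreeWithRootAtInfinity V) : Nonempty V :=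
  let ⟨r, _⟩ := Quotient.exists_rep T.root
  ⟨r.vertex 0⟩

end TreeWithRootAtInfinity

theorem eLpNorm_mulLeft_le {α : Type*} [MeasurableSpace α] (μ : Measure α) (p : ℝ≥0∞) {u : α → ℂ}
    (hu : ∀ x, ‖u x‖ = 1) (f : α → ℂ) : eLpNorm (LinearMap.mulLeft ℂ u f) p μ ≤ eLpNorm f p μ :=
  eLpNorm_mono fun x => by simp [hu x]

/-! ### The shift, its adjoint and the flow measure -/

namespace FlowMeasure

variable {V : Type*} {T : TreeWithRootAtInfinity V} (m : FlowMeasure T)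

theorem mass_ne_zero (x : V) : (m.mass x : ℂ) ≠ 0 := by exact_mod_cast (m.mass_pos x).ne'

theorem sum_mass_successors (x : V) : ∑ y ∈ T.successors x, (m.mass y : ℂ) = m.mass x := by
  rw [m.flow x]; push_cast; rfl

theorem sum_mass_div_mass (x : V) : ∑ y ∈ T.successors x, m.mass y / m.mass x = 1 := by
  rw [← Finset.sum_div, ← m.flow x, div_self (m.mass_pos x).ne']

theorem shiftAdjoint_shift (f : V → ℂ) : m.shiftAdjoint (m.shift f) = f := by
  ext x
  have h : ∑ y ∈ T.successors x, m.shift f y * (m.mass y : ℂ) = f x * m.mass x := by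
    rw [← m.sum_mass_successors x, Finset.mul_sum]
    refine Finset.sum_congr rfl fun y hy => ?_
    rw [shift, T.mem_successors.1 hy]
  rw [shiftAdjoint, h]
  field_simp [m.mass_ne_zero x]

/-- The shift operator as a linear map on all functions. -/
noncomputable def shiftLinearMap : (V → ℂ) →ₗ[ℂ] (V → ℂ) where
  toFun := m.shift
  map_add' _ _ := rfl
  map_smul' _ _ := rfl

/-- The adjoint of the shift operator as a linear map on all functions. -/
noncomputable def shiftAdjointLinearMap : (V → ℂ) →ₗ[ℂ] (V → ℂ) where
  toFun := m.shiftAdjoint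
  map_add' f g := by
    ext x
    simp [shiftAdjoint, add_mul, Finset.sum_add_distrib, mul_add]
  map_smul' c f := by
    ext x
    simp only [shiftAdjoint, Pi.smul_apply, smul_eq_mul, RingHom.id_apply, mul_assoc,
      ← Finset.mul_sum]
    ring

theorem shiftLinearMap_apply (f : V → ℂ) (x : V) : m.shiftLinearMap f x = f (T.pred x) := rfl

theorem laplacian_eq (f : V → ℂ) :
    m.laplacian f = f - (1 / 2 : ℂ) • (m.shift f + m.shiftAdjoint f) := by
  have h : m.shiftAdjoint (m.gradient f) = m.shiftAdjoint f - f := by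
    have h1 := m.shiftAdjointLinearMap.map_sub f (m.shift f)
    have h2 : m.shiftAdjointLinearMap (m.shift f) = f := m.shiftAdjoint_shift f
    rw [h2] at h1
    exact h1
  ext x
  simp only [laplacian, gradientAdjoint, h, gradient, Pi.sub_apply, Pi.smul_apply, Pi.add_apply,
    smul_eq_mul]
  ring

/-- The successor sets partition the vertices: each `y` belongs only to that of `T.pred y`. -/
theorem tsum_sum_successors (T : TreeWithRootAtInfinity V) (g : V → ℝ≥0∞) :
    ∑' x, ∑ y ∈ T.successors x, g y = ∑' y, g y := by
  classical
  have h : ∀ x, ∑ y ∈ T.successors x, g y = ∑' y, if x = T.pred y then g y else 0 := by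
    intro x
    rw [tsum_eq_sum (s := T.successors x)]
    · exact Finset.sum_congr rfl fun y hy => (if_pos (T.mem_successors.1 hy).symm).symm
    · exact fun y hy => if_neg fun h => hy (T.mem_successors.2 h.symm)
  simp_rw [h]
  rw [ENNReal.tsum_comm]
  simp

theorem ofReal_mass_eq_sum (x : V) :
    ENNReal.ofReal (m.mass x) = ∑ y ∈ T.successors x, ENNReal.ofReal (m.mass y) := by
  rw [← ENNReal.ofReal_sum_of_nonneg fun y _ => (m.mass_pos y).le, ← m.flow x]

theorem enorm_shiftAdjoint_le (f : V → ℂ) (x : V) :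
    ‖m.shiftAdjoint f x‖ₑ ≤
      ∑ y ∈ T.successors x, ENNReal.ofReal (m.mass y / m.mass x) * ‖f y‖ₑ := by
  have h : m.shiftAdjoint f x = ∑ y ∈ T.successors x, ((m.mass y / m.mass x : ℝ) : ℂ) * f y := by
    rw [shiftAdjoint, Finset.mul_sum]
    refine Finset.sum_congr rfl fun y _ => ?_
    push_cast
    ring
  rw [h]
  refine (enorm_sum_le _ _).trans (Finset.sum_le_sum fun y _ => ?_)
  rw [enorm_mul, ← ofReal_norm ((_ : ℝ) : ℂ), Complex.norm_real,
    Real.norm_of_nonneg (div_nonneg (m.mass_pos y).le (m.mass_pos x).le)]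

theorem sum_ofReal_mass_div_mass (x : V) :
    ∑ y ∈ T.successors x, ENNReal.ofReal (m.mass y / m.mass x) = 1 := by
  rw [← ENNReal.ofReal_sum_of_nonneg fun y _ => div_nonneg (m.mass_pos y).le (m.mass_pos x).le,
    m.sum_mass_div_mass, ENNReal.ofReal_one]

variable [MeasurableSpace V] [DiscreteMeasurableSpace V]

/-- Every vertex has positive mass, so `L^p` classes are genuine functions and pointwise identities
pass to operators. -/
theorem ae_iff_forall {P : V → Prop} : (∀ᵐ x ∂m.toMeasure, P x) ↔ ∀ x, P x := by
  rw [toMeasure, ae_withDensity_iff (Measurable.of_discrete), Measure.ae_count_iff]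
  exact forall_congr' fun x => by simp [m.mass_pos x]

theorem ae_eq_iff_eq {β : Type*} {f g : V → β} : f =ᵐ[m.toMeasure] g ↔ f = g := by
  rw [Filter.EventuallyEq, ae_iff_forall, funext_iff]

theorem lintegral_toMeasure (g : V → ℝ≥0∞) :
    ∫⁻ x, g x ∂m.toMeasure = ∑' x, ENNReal.ofReal (m.mass x) * g x := by
  rw [toMeasure, lintegral_withDensity_eq_lintegral_mul _ Measurable.of_discrete
    Measurable.of_discrete, lintegral_count]
  rfl

theorem lintegral_comp_pred (g : V → ℝ≥0∞) :
    ∫⁻ x, g (T.pred x) ∂m.toMeasure = ∫⁻ x, g x ∂m.toMeasure := by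
  rw [lintegral_toMeasure, lintegral_toMeasure, ← tsum_sum_successors T fun y => _ * g (T.pred y)]
  refine tsum_congr fun x => ?_
  rw [m.ofReal_mass_eq_sum x, Finset.sum_mul]
  exact Finset.sum_congr rfl fun y hy => by rw [T.mem_successors.1 hy]

theorem measurePreserving_pred : MeasurePreserving T.pred m.toMeasure m.toMeasure := by
  refine ⟨Measurable.of_discrete, Measure.ext fun s hs => ?_⟩
  rw [← lintegral_indicator_one hs, lintegral_map Measurable.of_discrete Measurable.of_discrete,
    m.lintegral_comp_pred, lintegral_indicator_one hs]

theorem lintegral_average (g : V → ℝ≥0∞) :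
    ∫⁻ x, ∑ y ∈ T.successors x, ENNReal.ofReal (m.mass y / m.mass x) * g y ∂m.toMeasure =
      ∫⁻ x, g x ∂m.toMeasure := by
  rw [lintegral_toMeasure, lintegral_toMeasure, ← tsum_sum_successors T fun y => _ * g y]
  refine tsum_congr fun x => ?_
  rw [Finset.mul_sum]
  refine Finset.sum_congr rfl fun y _ => ?_
  rw [← mul_assoc, ← ENNReal.ofReal_mul (m.mass_pos x).le, mul_div_cancel₀ _ (m.mass_pos x).ne']

/-! ### Contractions of `L^p(m)` -/

variable {p : ℝ≥0∞}

theorem eLpNorm_shift (f : V → ℂ) :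
    eLpNorm (m.shift f) p m.toMeasure = eLpNorm f p m.toMeasure :=
  eLpNorm_comp_measurePreserving
    (Measurable.of_discrete (f := f)).aestronglyMeasurable m.measurePreserving_pred

theorem eLpNorm_shiftLinearMap_le (f : V → ℂ) :
    eLpNorm (m.shiftLinearMap f) p m.toMeasure ≤ eLpNorm f p m.toMeasure :=
  (m.eLpNorm_shift f).le

/-- `Σ*` averages with weights `m(y)/m(x)` of sum 1: for finite `p` use Jensen's inequality and
`lintegral_average`, for `p = ∞` the trivial bound. -/
theorem eLpNorm_shiftAdjoint_le (hp : 1 ≤ p) (f : V → ℂ) :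
    eLpNorm (m.shiftAdjoint f) p m.toMeasure ≤ eLpNorm f p m.toMeasure := by
  rcases eq_or_ne p ∞ with rfl | hp'
  · rw [eLpNorm_exponent_top, eLpNorm_exponent_top]
    refine eLpNormEssSup_le_of_ae_enorm_bound (m.ae_iff_forall.2 fun x => ?_)
    have h := m.ae_iff_forall.1 (enorm_ae_le_eLpNormEssSup f m.toMeasure)
    refine (m.enorm_shiftAdjoint_le f x).trans ?_
    calc _ ≤ ∑ y ∈ T.successors x, ENNReal.ofReal (m.mass y / m.mass x) *
          eLpNormEssSup f m.toMeasure := by gcongr; exact h _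
      _ = _ := by rw [← Finset.sum_mul, m.sum_ofReal_mass_div_mass, one_mul]
  · have hp0 : p ≠ 0 := (zero_lt_one.trans_le hp).ne'
    have hp1 : 1 ≤ p.toReal := by
      rw [← ENNReal.toReal_one]; exact ENNReal.toReal_mono hp' hp
    rw [eLpNorm_eq_lintegral_rpow_enorm_toReal hp0 hp',
      eLpNorm_eq_lintegral_rpow_enorm_toReal hp0 hp',
      ← m.lintegral_average (fun x => ‖f x‖ₑ ^ p.toReal)]
    gcongr with x
    exact (ENNReal.rpow_le_rpow (m.enorm_shiftAdjoint_le f x) (by positivity)).trans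
      (ENNReal.rpow_arith_mean_le_arith_mean_rpow _ _ _ (m.sum_ofReal_mass_div_mass x) hp1)

theorem coeFn_add_eq (f g : Lp ℂ p m.toMeasure) : ⇑(f + g) = ⇑f + ⇑g :=
  m.ae_eq_iff_eq.1 (Lp.coeFn_add f g)

theorem coeFn_sub_eq (f g : Lp ℂ p m.toMeasure) : ⇑(f - g) = ⇑f - ⇑g :=
  m.ae_eq_iff_eq.1 (Lp.coeFn_sub f g)

theorem coeFn_smul_eq (c : ℂ) (f : Lp ℂ p m.toMeasure) : ⇑(c • f) = c • ⇑f :=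
  m.ae_eq_iff_eq.1 (Lp.coeFn_smul c f)

theorem coeFn_toLp_eq {f : V → ℂ} (hf : MemLp f p m.toMeasure) : ⇑(hf.toLp f) = f :=
  m.ae_eq_iff_eq.1 hf.coeFn_toLp

theorem lp_ext {f g : Lp ℂ p m.toMeasure} (h : (f : V → ℂ) = g) : f = g :=
  Lp.ext (m.ae_eq_iff_eq.2 h)

/-- Needed for the identity operator to have norm 1. -/
theorem nontrivial_lp : Nontrivial (Lp ℂ p m.toMeasure) := by
  classical
  obtain ⟨x⟩ := T.nonempty
  have hfin : m.toMeasure {x} ≠ ∞ := by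
    rw [← lintegral_indicator_one (MeasurableSet.singleton x), lintegral_toMeasure,
      tsum_eq_single x fun y hy => by simp [hy]]
    simp
  refine ⟨indicatorConstLp p (MeasurableSet.singleton x) hfin (1 : ℂ), 0, fun h => ?_⟩
  have h1 := m.ae_eq_iff_eq.1 ((indicatorConstLp_coeFn (p := p) (hs := MeasurableSet.singleton x)
    (hμs := hfin) (c := (1 : ℂ))).symm.trans (h ▸ Lp.coeFn_zero ℂ p m.toMeasure))
  simpa using congrFun h1 x

theorem memLp_map_of_eLpNorm_le {Φ : (V → ℂ) →ₗ[ℂ] (V → ℂ)}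
    (hΦ : ∀ f, eLpNorm (Φ f) p m.toMeasure ≤ eLpNorm f p m.toMeasure)
    (f : Lp ℂ p m.toMeasure) : MemLp (Φ f) p m.toMeasure :=
  ⟨Measurable.of_discrete.aestronglyMeasurable, (hΦ f).trans_lt (Lp.memLp f).2⟩

variable [Fact (1 ≤ p)]

/-- A linear map on functions which does not increase the `L^p` norm, as an operator on `L^p`. -/
noncomputable def lpLift (Φ : (V → ℂ) →ₗ[ℂ] (V → ℂ))
    (hΦ : ∀ f, eLpNorm (Φ f) p m.toMeasure ≤ eLpNorm f p m.toMeasure) :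
    Lp ℂ p m.toMeasure →L[ℂ] Lp ℂ p m.toMeasure :=
  LinearMap.mkContinuous
    { toFun := fun f => (m.memLp_map_of_eLpNorm_le hΦ f).toLp (Φ f)
      map_add' := fun f g => m.lp_ext (by simp only [coeFn_toLp_eq, coeFn_add_eq, map_add])
      map_smul' := fun c f => m.lp_ext (by
        simp only [coeFn_toLp_eq, coeFn_smul_eq, map_smul, RingHom.id_apply]) }
    1 fun f => by
      simp only [LinearMap.coe_mk, AddHom.coe_mk, one_mul]
      rw [Lp.norm_toLp, Lp.norm_def]
      exact ENNReal.toReal_mono (Lp.eLpNorm_ne_top f) (hΦ f)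

variable {Φ : (V → ℂ) →ₗ[ℂ] (V → ℂ)}
  (hΦ : ∀ f, eLpNorm (Φ f) p m.toMeasure ≤ eLpNorm f p m.toMeasure)

theorem coeFn_lpLift (f : Lp ℂ p m.toMeasure) : ⇑(m.lpLift Φ hΦ f) = Φ f :=
  m.coeFn_toLp_eq (m.memLp_map_of_eLpNorm_le hΦ f)

theorem norm_lpLift_le : ‖m.lpLift Φ hΦ‖ ≤ 1 :=
  ContinuousLinearMap.opNorm_le_bound _ zero_le_one fun f => by
    rw [one_mul, Lp.norm_def, Lp.norm_def, coeFn_lpLift]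
    exact ENNReal.toReal_mono (Lp.eLpNorm_ne_top f) (hΦ f)

theorem lpLift_mul_lpLift_eq_one {Ψ : (V → ℂ) →ₗ[ℂ] (V → ℂ)}
    (hΨ : ∀ f, eLpNorm (Ψ f) p m.toMeasure ≤ eLpNorm f p m.toMeasure) (h : ∀ f, Φ (Ψ f) = f) :
    m.lpLift Φ hΦ * m.lpLift Ψ hΨ = 1 :=
  ContinuousLinearMap.ext fun f => m.lp_ext (by
    rw [mul_apply_eq_comp, coeFn_lpLift, coeFn_lpLift, h,
      one_apply_eq_self])

/-- Conjugate by multiplication with `c ^ (-l)`, which is isometric since `|c| = 1`; a factor `c`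
remains because `l` rises by one at the predecessor. -/
theorem exists_units_conj_shift {c : ℂ} (hc : ‖c‖ = 1) :
    ∃ u : (Lp ℂ p m.toMeasure →L[ℂ] Lp ℂ p m.toMeasure)ˣ,
      u.val * m.lpLift (p := p) m.shiftLinearMap m.eLpNorm_shiftLinearMap_le * u⁻¹.val =
        c • m.lpLift m.shiftLinearMap m.eLpNorm_shiftLinearMap_le := by
  have hc0 : c ≠ 0 := by rintro rfl; simp at hc
  obtain ⟨l, hl⟩ := T.exists_level
  have h1 : ∀ x, ‖c ^ (-l x)‖ = 1 := fun x => by simp [hc]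
  have h2 : ∀ x, ‖c ^ l x‖ = 1 := fun x => by simp [hc]
  refine ⟨⟨m.lpLift _ (eLpNorm_mulLeft_le _ p h1), m.lpLift _ (eLpNorm_mulLeft_le _ p h2),
    m.lpLift_mul_lpLift_eq_one _ _ fun f => ?_, m.lpLift_mul_lpLift_eq_one _ _ fun f => ?_⟩, ?_⟩
  · ext x
    simp [zpow_ne_zero (l x) hc0]
  · ext x
    simp [zpow_ne_zero (l x) hc0]
  · refine ContinuousLinearMap.ext fun f => m.lp_ext ?_
    simp only [Units.val_mk, Units.inv_mk, mul_apply_eq_comp,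
      _root_.smul_apply, coeFn_lpLift, coeFn_smul_eq]
    ext x
    simp only [LinearMap.mulLeft_apply, Pi.mul_apply, Pi.smul_apply, smul_eq_mul,
      shiftLinearMap_apply, hl, zpow_neg, zpow_add₀ hc0, zpow_one]
    field_simp

end FlowMeasure

/-- For a flow tree `(T, m)` and `p ∈ [1, ∞]`, the flow Laplacian defines a bounded operator on
the complex Lebesgue space `L^p(m)` (necessarily unique), and its spectrum is `[0, 2]`. -/
theorem corollary5p7 {V : Type*} [MeasurableSpace V] [DiscreteMeasurableSpace V]
    (T : TreeWithRootAtInfinity V) (m : FlowMeasure T) (p : ℝ≥0∞) [Fact (1 ≤ p)] :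
    ∃ L : Lp ℂ p m.toMeasure →L[ℂ] Lp ℂ p m.toMeasure,
      (∀ f : Lp ℂ p m.toMeasure,
        (L f : V → ℂ) =ᵐ[m.toMeasure] m.laplacian (f : V → ℂ)) ∧
      spectrum ℂ L = ((↑) : ℝ → ℂ) '' Set.Icc 0 2 := by
  have := m.nontrivial_lp (p := p)
  have hA : ∀ f, eLpNorm (m.shiftAdjointLinearMap f) p m.toMeasure ≤ eLpNorm f p m.toMeasure :=
    m.eLpNorm_shiftAdjoint_le (p := p) Fact.out
  refine ⟨1 - (1 / 2 : ℂ) •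
    (m.lpLift m.shiftLinearMap m.eLpNorm_shiftLinearMap_le +
      m.lpLift m.shiftAdjointLinearMap hA), fun f => ?_, ?_⟩
  · rw [m.ae_eq_iff_eq, m.laplacian_eq]
    simp only [_root_.sub_apply, one_apply_eq_self,
      _root_.smul_apply, _root_.add_apply, m.coeFn_sub_eq,
      m.coeFn_smul_eq, m.coeFn_add_eq, m.coeFn_lpLift]
    rfl
  · exact spectrum_one_sub_half_add (m.lpLift_mul_lpLift_eq_one _ _ m.shiftAdjoint_shift)
      (m.norm_lpLift_le _) (m.norm_lpLift_le _) fun c hc => m.exists_units_conj_shift hc
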